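/- Let $b\ge 0$, $c\ge 0$, $a\ge 0$ be constants and let $n$ be a measure on $(0,\infty)$ such that $(1\wedge u)\,n(du)$ is a finite measure. For $z\ge 0$ put $$\phi(z)=bz+cz^2,\qquad \psi(z)=az+\int_0^\infty (1-e^{-zu})\,n(du),$$ and for $\lambda\ge 0$ let $t\mapsto v_t(\lambda)$ be the solution of $\frac{\partial}{\partial t}v_t(\lambda)=-\phi(v_t(\lambda))$, $v_0(\lambda)=\lambda$ (positive if $\lambda>0$). Suppose that $\phi(z)\ne 0$ for all $z>0$ and that $\int_0^\lambda \frac{\psi(z)}{\phi(z)}\,dz<\infty$ for some $\lambda>0$. Let $(P_t)_{t\ge 0}$ be the transition semigroup on $\mathbb{R}_+=[0,\infty)$ of the continuous-state branching process with immigration (CBI-process) with branching mechanism $\phi$ and immigration rate $\psi$, that is, $$\int_0^\infty e^{-\lambda y}P_t(x,dy)=\exp\Big\{-x\,v_t(\lambda)-\int_0^t\psi(v_s(\lambda))\,ds\Big\},\qquad t,x,\lambda\ge 0,$$ and let $\eta$ be the probability measure on $\mathbb{R}_+$ with Laplace transform $$\int_0^\infty e^{-\lambda y}\,\eta(dy)=\exp\Big\{-\int_0^\infty\psi(v_s(\lambda))\,ds\Big\},\qquad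 \lambda\ge 0.$$ Let $\{Y_t:t\in\mathbb{R}\}$ be a stationary CBI-process, i.e. an $\mathbb{R}_+$-valued process whose finite-dimensional distributions are, for $t_1<t_2<\cdots<t_m$ in $\mathbb{R}$, $$\mathbf{P}(Y_{t_1}\in dx_1,\dots,Y_{t_m}\in dx_m)=\eta(dx_1)P_{t_2-t_1}(x_1,dx_2)\cdots P_{t_m-t_{m-1}}(x_{m-1},dx_m).$$ Then $\{Y_t:t\in\mathbb{R}\}$ is ergodic. That is, let $\mathbf{P}_Y$ be the law of $Y$ on the path space $\mathbb{R}_+^{\mathbb{R}}$ with the product $\sigma$-algebra, and let $(\theta_h x)(t)=x(t+h)$. Then every $\theta_h$, $h\in\mathbb{R}$, preserves $\mathbf{P}_Y$, and every measurable set $A$ such that $\mathbf{P}_Y(\theta_h^{-1}A\,\triangle\,A)=0$ for all $h\in\mathbb{R}$ satisfies $\mathbf{P}_Y(A)\in\{0,1\}$; moreover, for each fixed $h>0$ the single shift $\theta_h$ is ergodic with respect to $\mathbf{P}_Y$. -/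

import Mathlib

open Set Filter MeasureTheory ProbabilityTheory
open scoped NNReal ENNReal

/-- The branching mechanism `φ(z) = b z + c z²`. -/
def branchingMechanism (b c z : ℝ) : ℝ := b * z + c * z ^ 2

/-- The solution `v_t(l)` of the Riccati equation `∂ₜ v = -φ(v)`, `v₀ = l`:
`v_t(l) = e^{-bt} l / (1 + c l ∫₀ᵗ e^{-bs} ds)`, where `∫₀ᵗ e^{-bs} ds` is `(1 - e^{-bt}) / b`
if `b ≠ 0` and `t` if `b = 0`. The theorems below show that this is the unique positive
solution. -/
noncomputable def cbExponent (b c t l : ℝ) : ℝ :=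
  Real.exp (-b * t) * l / (1 + c * l * ∫ s in (0 : ℝ)..t, Real.exp (-b * s))

/-- The immigration rate `ψ(z) = a z + ∫_{(0,∞)} (1 - e^{-zu}) n(du)`. Only the restriction of `n`
to `(0,∞)` plays a role. -/
noncomputable def immigrationRate (a : ℝ) (n : Measure ℝ) (z : ℝ) : ℝ :=
  a * z + ∫ u in Ioi (0 : ℝ), (1 - Real.exp (-(z * u))) ∂n

theorem cbExponent_denom_pos (b : ℝ) {c t l : ℝ} (hc : 0 ≤ c) (hl : 0 ≤ l) (ht : 0 ≤ t) :
    0 < 1 + c * l * ∫ s in (0 : ℝ)..t, Real.exp (-b * s) := by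
  have : 0 ≤ ∫ s in (0 : ℝ)..t, Real.exp (-b * s) :=
    intervalIntegral.integral_nonneg ht fun _ _ => (Real.exp_pos _).le
  positivity

theorem cbExponent_zero (b c l : ℝ) : cbExponent b c 0 l = l := by
  simp [cbExponent]

theorem cbExponent_pos (b : ℝ) {c t l : ℝ} (hc : 0 ≤ c) (hl : 0 < l) (ht : 0 ≤ t) :
    0 < cbExponent b c t l :=
  div_pos (mul_pos (Real.exp_pos _) hl) (cbExponent_denom_pos b hc hl.le ht)

theorem cbExponent_hasDerivAt (b : ℝ) {c t l : ℝ} (hc : 0 ≤ c) (hl : 0 ≤ l) (ht : 0 ≤ t) :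
    HasDerivAt (fun r => cbExponent b c r l)
      (-branchingMechanism b c (cbExponent b c t l)) t := by
  have hD := (cbExponent_denom_pos b hc hl ht).ne'
  have hcont : Continuous fun s : ℝ => Real.exp (-b * s) := by fun_prop
  have h1 : HasDerivAt (fun r => ∫ s in (0 : ℝ)..r, Real.exp (-b * s)) (Real.exp (-b * t)) t :=
    intervalIntegral.integral_hasDerivAt_right (hcont.intervalIntegrable _ _)
      (hcont.stronglyMeasurableAtFilter _ _) hcont.continuousAt
  have h2 : HasDerivAt (fun r : ℝ => Real.exp (-b * r)) (Real.exp (-b * t) * (-b)) t := by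
    simpa using ((hasDerivAt_id t).const_mul (-b)).exp
  have h3 := (h2.mul_const l).div ((h1.const_mul (c * l)).const_add 1) hD
  refine h3.congr_deriv ?_
  simp only [branchingMechanism, cbExponent]
  field_simp
  ring

theorem cbExponent_unique (b : ℝ) {c l : ℝ} (hc : 0 ≤ c) (hl : 0 ≤ l) (w : ℝ → ℝ)
    (hw0 : w 0 = l)
    (hw : ∀ t, 0 ≤ t → HasDerivWithinAt w (-branchingMechanism b c (w t)) (Ici 0) t)
    (t : ℝ) (ht : 0 ≤ t) : w t = cbExponent b c t l := by
  have hwc : ContinuousOn w (Icc 0 t) := fun s hs =>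
    ((hw s hs.1).continuousWithinAt).mono Icc_subset_Ici_self
  have hvc : ContinuousOn (fun r => cbExponent b c r l) (Icc 0 t) := fun s hs =>
    (cbExponent_hasDerivAt b hc hl hs.1).continuousAt.continuousWithinAt
  obtain ⟨M, hM⟩ := isCompact_Icc.exists_bound_of_continuousOn hwc
  obtain ⟨N, hN⟩ := isCompact_Icc.exists_bound_of_continuousOn hvc
  set R := max M N
  have hR : 0 ≤ R := le_trans (norm_nonneg _) ((hM 0 ⟨le_rfl, ht⟩).trans (le_max_left _ _))
  have hlip : LipschitzOnWith (Real.toNNReal (|b| + c * (2 * R)))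
      (fun z => -branchingMechanism b c z) (Icc (-R) R) := by
    refine LipschitzOnWith.of_dist_le_mul fun x hx y hy => ?_
    have hK : 0 ≤ |b| + c * (2 * R) := by positivity
    rw [Real.coe_toNNReal _ hK, Real.dist_eq, Real.dist_eq]
    have e : -branchingMechanism b c x - -branchingMechanism b c y
        = -((b + c * (x + y)) * (x - y)) := by
      simp only [branchingMechanism]; ring
    rw [e, abs_neg, abs_mul]
    refine mul_le_mul_of_nonneg_right ?_ (abs_nonneg _)
    refine (abs_add_le _ _).trans (add_le_add_right ?_ _)
    rw [abs_mul, abs_of_nonneg hc]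
    refine mul_le_mul_of_nonneg_left ?_ hc
    rw [abs_le]
    constructor <;> linarith [hx.1, hx.2, hy.1, hy.2]
  have key := ODE_solution_unique_of_mem_Icc_right (v := fun _ z => -branchingMechanism b c z)
    (s := fun _ => Icc (-R) R) (f := w) (g := fun r => cbExponent b c r l)
    (K := Real.toNNReal (|b| + c * (2 * R))) (a := 0) (b := t)
    (fun _ _ => hlip) hwc
    (fun s hs => (hw s hs.1).mono (Ici_subset_Ici.2 hs.1))
    (fun s hs => abs_le.1 ((hM s ⟨hs.1, hs.2.le⟩).trans (le_max_left _ _)))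
    hvc
    (fun s hs => (cbExponent_hasDerivAt b hc hl hs.1).hasDerivWithinAt)
    (fun s hs => abs_le.1 ((hN s ⟨hs.1, hs.2.le⟩).trans (le_max_right _ _)))
    (by simp [hw0, cbExponent_zero])
  exact key ⟨ht, le_rfl⟩

/-- A transition semigroup on the state space `ℝ₊`: probability kernels `P_t`, `t ≥ 0`, with
`P_0(x,·) = δ_x` and the Chapman–Kolmogorov equations. -/
structure IsTransitionSemigroup (P : ℝ≥0 → Kernel ℝ≥0 ℝ≥0) : Prop where
  isMarkovKernel : ∀ t, IsMarkovKernel (P t)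
  zero : P 0 = Kernel.id
  add : ∀ s t, P (s + t) = P t ∘ₖ P s

/-- `P` is the transition semigroup of the CBI-process with branching mechanism
`φ(z) = b z + c z²` and immigration rate `ψ(z) = a z + ∫_{(0,∞)} (1 - e^{-zu}) n(du)`:
`∫ e^{-l y} P_t(x,dy) = exp(- x v_t(l) - ∫₀ᵗ ψ(v_s(l)) ds)` for all `l ≥ 0`. -/
structure IsCBISemigroup (b c a : ℝ) (n : Measure ℝ) (P : ℝ≥0 → Kernel ℝ≥0 ℝ≥0) : Prop
    extends IsTransitionSemigroup P where
  laplace : ∀ (t x : ℝ≥0) (l : ℝ), 0 ≤ l →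
    ∫ y, Real.exp (-(l * (y : ℝ))) ∂(P t x) =
      Real.exp (-((x : ℝ) * cbExponent b c t l)
        - ∫ s in (0 : ℝ)..t, immigrationRate a n (cbExponent b c s l))

/-- `η` is the probability measure on `ℝ₊` with Laplace transform
`l ↦ exp(- ∫₀^∞ ψ(v_s(l)) ds)`, `l ≥ 0`. -/
structure IsCBIStationaryLaw (b c a : ℝ) (n : Measure ℝ) (η : Measure ℝ≥0) : Prop where
  isProbabilityMeasure : IsProbabilityMeasure η
  laplace : ∀ l : ℝ, 0 ≤ l →
    ∫ y, Real.exp (-(l * (y : ℝ))) ∂η =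
      Real.exp (-∫ s in Ioi (0 : ℝ), immigrationRate a n (cbExponent b c s l))

/-- The measure `η(dx₀) P_{t₁-t₀}(x₀,dx₁) ⋯ P_{t_m-t_{m-1}}(x_{m-1},dx_m)` on `ℝ₊^{m+1}`,
for `t₀ < t₁ < ⋯ < t_m`. -/
noncomputable def markovFDD (η : Measure ℝ≥0) (P : ℝ≥0 → Kernel ℝ≥0 ℝ≥0) :
    (m : ℕ) → (Fin (m + 1) → ℝ) → Measure (Fin (m + 1) → ℝ≥0)
  | 0, _ => η.map fun x _ => x
  | m + 1, t =>
    ((markovFDD η P m fun i => t i.castSucc) ⊗ₘ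
      ((P (t (Fin.last (m + 1)) - t (Fin.last m).castSucc).toNNReal).comap
        (fun x : Fin (m + 1) → ℝ≥0 => x (Fin.last m)) (measurable_pi_apply _))).map
      fun p => Fin.snoc (α := fun _ => ℝ≥0) p.1 p.2

/-- The process `Y`, indexed by `ℝ`, has the finite-dimensional distributions
`η(dx₀) P_{t₁-t₀}(x₀,dx₁) ⋯ P_{t_m-t_{m-1}}(x_{m-1},dx_m)`. -/
def HasMarkovFDD {Ω : Type*} [MeasurableSpace Ω] (μ : Measure Ω) (Y : ℝ → Ω → ℝ≥0)
    (η : Measure ℝ≥0) (P : ℝ≥0 → Kernel ℝ≥0 ℝ≥0) : Prop :=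
  ∀ (m : ℕ) (t : Fin (m + 1) → ℝ), StrictMono t →
    μ.map (fun ω i => Y (t i) ω) = markovFDD η P m t

/-- The law of a process on the path space `ℝ₊^ℝ` with its cylinder σ-algebra. -/
noncomputable def pathLaw {Ω : Type*} [MeasurableSpace Ω] (μ : Measure Ω) (Y : ℝ → Ω → ℝ≥0) :
    Measure (ℝ → ℝ≥0) :=
  μ.map fun ω t => Y t ω

/-- The time shift `θ_h` on paths: `(θ_h x)(t) = x(h + t)`. -/
def timeShift (h : ℝ) (x : ℝ → ℝ≥0) : ℝ → ℝ≥0 := fun t => x (h + t)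

/-- Ergodicity of a process indexed by `ℝ`: the flow of all time shifts preserves the law of the
process, and every measurable set `A` of paths such that for each `h` the set `θ_h⁻¹ A` equals `A`
up to a null set has probability `0` or `1`. (Exact invariance would be a void condition, as `∅`
and the whole path space are the only cylinder-measurable sets that are exactly invariant under
all shifts.) -/
structure IsErgodicProcess {Ω : Type*} [MeasurableSpace Ω] (μ : Measure Ω)
    (Y : ℝ → Ω → ℝ≥0) : Prop where
  measurePreserving : ∀ h, MeasurePreserving (timeShift h) (pathLaw μ Y) (pathLaw μ Y)
  zero_or_one : ∀ A : Set (ℝ → ℝ≥0), MeasurableSet A →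
    (∀ h, timeShift h ⁻¹' A =ᵐ[pathLaw μ Y] A) → pathLaw μ Y A = 0 ∨ pathLaw μ Y A = 1

/-! Each shift `θ_h`, `h > 0`, is mixing on the exponentials `laplaceExp l`. By the Markov property,
the part of an exponential supported on times `≥ s` collapses to a constant `C` times an exponential
of weight `w` at time `s`. Carrying that weight back across a gap `τ` produces the factor `exp(-∫₀^τ
ψ(v_u(w)) du)` and leaves the weight `v_τ(w)`. As `τ → ∞` this weight vanishes and the factor tends
to the Laplace transform of `η` at `w`, so the two groups of times decouple.

The integral converges because `z = v_u(w)` turns `ψ(v_u(w)) du` into `ψ(z)/φ(z) dz`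
(`integrableOn_immigrationRate_cbExponent`).

Exponentials suffice: they determine finite measures on path space (`ext_of_integral_laplaceExp`),
hence are total in `L²`, and mixing against a total family forces invariant sets to be trivial
(`ergodic_of_tendsto_integral_laplaceExp`). -/

open scoped Topology BoundedContinuousFunction

/-! ### Laplace functionals determine finite measures -/

section LaplaceFunctional

variable {ι : Type*}

/-- The exponential `x ↦ exp(-∑ᵢ lᵢ xᵢ)` of a finitely supported linear functional. -/
noncomputable def laplaceExp (l : ι →₀ ℝ≥0) (x : ι → ℝ≥0) : ℝ :=
  Real.exp (-(l.sum fun i r => (r : ℝ) * (x i : ℝ)))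

theorem laplaceExp_zero (x : ι → ℝ≥0) : laplaceExp 0 x = 1 := by simp [laplaceExp]

theorem laplaceExp_add (l m : ι →₀ ℝ≥0) (x : ι → ℝ≥0) :
    laplaceExp (l + m) x = laplaceExp l x * laplaceExp m x := by
  classical
  rw [laplaceExp, Finsupp.sum_add_index' (by simp) (by intros; push_cast; ring), laplaceExp,
    laplaceExp, ← Real.exp_add, neg_add]

theorem laplaceExp_single (i : ι) (r : ℝ≥0) (x : ι → ℝ≥0) :
    laplaceExp (Finsupp.single i r) x = Real.exp (-((r : ℝ) * (x i : ℝ))) := by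
  simp [laplaceExp]

theorem laplaceExp_mapDomain {κ : Type*} (f : ι → κ) (l : ι →₀ ℝ≥0) (x : κ → ℝ≥0) :
    laplaceExp (l.mapDomain f) x = laplaceExp l (x ∘ f) := by
  rw [laplaceExp, Finsupp.sum_mapDomain_index (by simp) (by intros; push_cast; ring)]
  rfl

theorem laplaceExp_pos (l : ι →₀ ℝ≥0) (x : ι → ℝ≥0) : 0 < laplaceExp l x := Real.exp_pos _

theorem laplaceExp_le_one (l : ι →₀ ℝ≥0) (x : ι → ℝ≥0) : laplaceExp l x ≤ 1 :=
  Real.exp_le_one_iff.2 (neg_nonpos.2 (Finset.sum_nonneg fun _ _ => by positivity))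

theorem norm_laplaceExp_le_one (l : ι →₀ ℝ≥0) (x : ι → ℝ≥0) : ‖laplaceExp l x‖ ≤ 1 := by
  rw [Real.norm_of_nonneg (laplaceExp_pos l x).le]
  exact laplaceExp_le_one l x

theorem continuous_laplaceExp (l : ι →₀ ℝ≥0) : Continuous (laplaceExp l) := by
  unfold laplaceExp Finsupp.sum
  fun_prop

@[fun_prop]
theorem measurable_laplaceExp (l : ι →₀ ℝ≥0) : Measurable (laplaceExp l) := by
  unfold laplaceExp Finsupp.sum
  fun_prop

theorem integrable_laplaceExp (l : ι →₀ ℝ≥0) (ν : Measure (ι → ℝ≥0)) [IsFiniteMeasure ν] :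
    Integrable (laplaceExp l) ν :=
  .of_bound (measurable_laplaceExp l).aestronglyMeasurable 1
    (ae_of_all _ (norm_laplaceExp_le_one l))

/-- `laplaceExp l` as a bounded continuous function. -/
noncomputable def laplaceExpBCF (l : ι →₀ ℝ≥0) : (ι → ℝ≥0) →ᵇ ℝ :=
  BoundedContinuousFunction.ofNormedAddCommGroup (laplaceExp l) (continuous_laplaceExp l) 1
    (norm_laplaceExp_le_one l)

theorem laplaceExpBCF_apply (l : ι →₀ ℝ≥0) (x : ι → ℝ≥0) :
    laplaceExpBCF l x = laplaceExp l x := rfl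

theorem ext_of_integral_laplaceExp_of_finite [Finite ι] {ν₁ ν₂ : Measure (ι → ℝ≥0)}
    [IsFiniteMeasure ν₁] [IsFiniteMeasure ν₂]
    (h : ∀ l, ∫ x, laplaceExp l x ∂ν₁ = ∫ x, laplaceExp l x ∂ν₂) : ν₁ = ν₂ := by
  have := Fintype.ofFinite ι
  let A : StarSubalgebra ℝ ((ι → ℝ≥0) →ᵇ ℝ) :=
    { Algebra.adjoin ℝ (range (laplaceExpBCF (ι := ι))) with
      star_mem' := fun {f} hf => by
        have : star f = f := by ext x; simp
        rwa [this] }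
  refine ext_of_forall_mem_subalgebra_integral_eq_of_polish (𝕜 := ℝ) (A := A) ?_ ?_
  · intro x y hxy
    obtain ⟨i, hi⟩ := Function.ne_iff.1 hxy
    refine ⟨laplaceExpBCF (Finsupp.single i 1), ⟨_, ⟨laplaceExpBCF (Finsupp.single i 1),
      Algebra.subset_adjoin (mem_range_self _), rfl⟩, rfl⟩, ?_⟩
    simpa [laplaceExpBCF_apply, laplaceExp_single] using hi
  · intro g hg
    -- Products of exponentials are exponentials, so the generated algebra is their linear span and
    -- equality of integrals need only be checked on generators.
    have hsub : (Submonoid.closure (range (laplaceExpBCF (ι := ι))) : Set ((ι → ℝ≥0) →ᵇ ℝ)) ⊆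
        (Submodule.span ℝ (range (laplaceExpBCF (ι := ι))) : Submodule ℝ ((ι → ℝ≥0) →ᵇ ℝ)) := by
      intro f hf
      refine Submodule.subset_span ?_
      induction hf using Submonoid.closure_induction with
      | mem f hf => exact hf
      | one => exact ⟨0, by ext x; simp [laplaceExpBCF_apply, laplaceExp_zero]⟩
      | mul f g _ _ hf hg =>
        obtain ⟨l, rfl⟩ := hf
        obtain ⟨m, rfl⟩ := hg
        exact ⟨l + m, by ext x; simp [laplaceExpBCF_apply, laplaceExp_add]⟩
    have hg' : g ∈ Submodule.span ℝ (range (laplaceExpBCF (ι := ι))) := by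
      rw [← Algebra.adjoin_eq_span_of_subset ℝ hsub]
      exact hg
    clear hg
    induction hg' using Submodule.span_induction with
    | mem f hf =>
      obtain ⟨l, rfl⟩ := hf
      exact h l
    | zero => simp
    | add f g _ _ hf hg =>
      simp only [BoundedContinuousFunction.coe_add, Pi.add_apply]
      rw [integral_add (f.integrable _) (g.integrable _),
        integral_add (f.integrable _) (g.integrable _)]
      rw [hf, hg]
    | smul r f _ hf =>
      simp only [BoundedContinuousFunction.coe_smul, integral_smul]
      rw [hf]

/-- A finite measure on `ℝ₊^ι`, with the cylinder σ-algebra, is determined by its Laplace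
functional. -/
theorem ext_of_integral_laplaceExp {ν₁ ν₂ : Measure (ι → ℝ≥0)}
    [IsFiniteMeasure ν₁] [IsFiniteMeasure ν₂]
    (h : ∀ l, ∫ x, laplaceExp l x ∂ν₁ = ∫ x, laplaceExp l x ∂ν₂) : ν₁ = ν₂ := by
  refine IsProjectiveLimit.unique (P := fun I : Finset ι => ν₁.map I.restrict)
    (fun _ => rfl) fun I => ?_
  refine ext_of_integral_laplaceExp_of_finite fun l => ?_
  have key (ν : Measure (ι → ℝ≥0)) : ∫ x, laplaceExp l x ∂(ν.map I.restrict) =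
      ∫ x, laplaceExp (l.mapDomain Subtype.val) x ∂ν := by
    rw [integral_map (by fun_prop) (by fun_prop)]
    simp only [laplaceExp_mapDomain]
    rfl
  rw [key, key, h]

end LaplaceFunctional

/-! ### Weak convergence and totality of exponentials in `L²` -/

/-- In a Hilbert space, a bounded sequence that tends weakly to `0` against a total set tends weakly
to `0`. -/
theorem tendsto_inner_zero_of_total {H : Type*} [NormedAddCommGroup H] [InnerProductSpace ℝ H]
    {w : ℕ → H} {C : ℝ} (hw : ∀ n, ‖w n‖ ≤ C) {S : Set H}
    (hS : (Submodule.span ℝ S).topologicalClosure = ⊤)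
    (h : ∀ s ∈ S, Tendsto (fun n => inner ℝ (w n) s) atTop (𝓝 0)) (g : H) :
    Tendsto (fun n => inner ℝ (w n) g) atTop (𝓝 0) := by
  have hspan : ∀ f ∈ Submodule.span ℝ S, Tendsto (fun n => inner ℝ (w n) f) atTop (𝓝 0) := by
    intro f hf
    induction hf using Submodule.span_induction with
    | mem f hf => exact h f hf
    | zero => simp
    | add f g _ _ hf hg => simpa [inner_add_right] using hf.add hg
    | smul r f _ hf => simpa [inner_smul_right] using hf.const_mul r
  have hC : 0 ≤ C := (norm_nonneg _).trans (hw 0)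
  rw [Metric.tendsto_atTop]
  intro ε hε
  have hg : g ∈ closure (Submodule.span ℝ S : Set H) := by
    rw [← Submodule.topologicalClosure_coe, hS]; trivial
  -- `C + 1` instead of `C`, since `C` may be `0`.
  obtain ⟨f, hf, hgf⟩ := Metric.mem_closure_iff.1 hg (ε / (2 * (C + 1))) (by positivity)
  obtain ⟨N, hN⟩ := Metric.tendsto_atTop.1 (hspan f hf) (ε / 2) (by positivity)
  refine ⟨N, fun n hn => ?_⟩
  have h1 := hN n hn
  rw [Real.dist_eq, sub_zero] at h1 ⊢
  have h2 : |inner ℝ (w n) (g - f)| ≤ C * ‖g - f‖ :=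
    (abs_real_inner_le_norm _ _).trans (by gcongr; exact hw n)
  rw [dist_eq_norm, lt_div_iff₀ (by positivity)] at hgf
  have h3 : inner ℝ (w n) g = inner ℝ (w n) (g - f) + inner ℝ (w n) f := by
    rw [← inner_add_right, sub_add_cancel]
  have h4 := abs_add_le (inner ℝ (w n) (g - f)) (inner ℝ (w n) f)
  rw [h3]
  nlinarith [norm_nonneg (g - f)]

section Density

variable {ι : Type*} (ρ : Measure (ι → ℝ≥0))

theorem memLp_laplaceExp [IsFiniteMeasure ρ] (l : ι →₀ ℝ≥0) : MemLp (laplaceExp l) 2 ρ :=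
  .of_bound (measurable_laplaceExp l).aestronglyMeasurable 1
    (ae_of_all _ (norm_laplaceExp_le_one l))

/-- The positive and negative parts of `g`, taken as densities, give two finite measures with the
same Laplace functional; these coincide, so the two parts agree a.e. and both vanish. -/
theorem ae_eq_zero_of_integral_laplaceExp_mul {g : (ι → ℝ≥0) → ℝ} (hg : Integrable g ρ)
    (h : ∀ l, ∫ x, laplaceExp l x * g x ∂ρ = 0) : g =ᵐ[ρ] 0 := by
  have hpos : IsFiniteMeasure (ρ.withDensity fun x => ENNReal.ofReal (g x)) :=
    isFiniteMeasure_withDensity_ofReal hg.2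
  have hneg : IsFiniteMeasure (ρ.withDensity fun x => ENNReal.ofReal (-g x)) :=
    isFiniteMeasure_withDensity_ofReal hg.neg.2
  have hint (f : (ι → ℝ≥0) → ℝ) (hf : Integrable f ρ) (l : ι →₀ ℝ≥0) :
      ∫ x, laplaceExp l x ∂(ρ.withDensity fun x => ENNReal.ofReal (f x)) =
        ∫ x, laplaceExp l x * max (f x) 0 ∂ρ := by
    rw [integral_withDensity_eq_integral_toReal_smul₀ hf.1.aemeasurable.ennreal_ofReal
      (ae_of_all _ fun _ => ENNReal.ofReal_lt_top)]
    refine integral_congr_ae (ae_of_all _ fun x => ?_)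
    simp only [ENNReal.toReal_ofReal', smul_eq_mul]
    ring
  have heq : (ρ.withDensity fun x => ENNReal.ofReal (g x)) =
      ρ.withDensity fun x => ENNReal.ofReal (-g x) := by
    refine ext_of_integral_laplaceExp fun l => ?_
    rw [hint g hg, hint (fun x => -g x) hg.neg, ← sub_eq_zero, ← integral_sub]
    · refine Eq.trans ?_ (h l)
      refine integral_congr_ae (ae_of_all _ fun x => ?_)
      change laplaceExp l x * max (g x) 0 - laplaceExp l x * max (-g x) 0 = laplaceExp l x * g x
      rw [← mul_sub]
      congr 1
      rcases le_total 0 (g x) with h0 | h0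
      · simp [h0]
      · simp [h0]
    · exact hg.pos_part.bdd_mul (measurable_laplaceExp l).aestronglyMeasurable
        (ae_of_all _ (norm_laplaceExp_le_one l))
    · exact hg.neg.pos_part.bdd_mul (measurable_laplaceExp l).aestronglyMeasurable
        (ae_of_all _ (norm_laplaceExp_le_one l))
  have hae := (withDensity_eq_iff hg.1.aemeasurable.ennreal_ofReal
    hg.neg.1.aemeasurable.ennreal_ofReal hg.lintegral_lt_top.ne).1 heq
  filter_upwards [hae] with x hx
  change _ = ENNReal.ofReal (-g x) at hx
  change g x = 0
  rcases le_total 0 (g x) with h0 | h0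
  · rw [ENNReal.ofReal_of_nonpos (neg_nonpos.2 h0), ENNReal.ofReal_eq_zero] at hx
    exact le_antisymm hx h0
  · rw [ENNReal.ofReal_of_nonpos h0, eq_comm, ENNReal.ofReal_eq_zero] at hx
    exact le_antisymm h0 (by simpa using hx)

theorem span_laplaceExp_dense [IsFiniteMeasure ρ] :
    (Submodule.span ℝ (range fun l => (memLp_laplaceExp ρ l).toLp)).topologicalClosure = ⊤ := by
  rw [Submodule.topologicalClosure_eq_top_iff, Submodule.eq_bot_iff]
  intro g hg
  refine (Lp.eq_zero_iff_ae_eq_zero).2 (ae_eq_zero_of_integral_laplaceExp_mul ρ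
    ((Lp.memLp g).integrable (by norm_num)) fun l => ?_)
  have := (Submodule.mem_orthogonal _ _).1 hg _ (Submodule.subset_span (mem_range_self l))
  rw [L2.inner_def] at this
  rw [← this]
  refine integral_congr_ae ?_
  filter_upwards [(memLp_laplaceExp ρ l).coeFn_toLp] with x hx
  rw [hx]
  simp [mul_comm]

end Density

/-! ### From mixing on exponentials to ergodicity -/

/-- A measure-preserving map of `ℝ₊^ι` that is mixing on exponentials is ergodic. -/
theorem ergodic_of_tendsto_integral_laplaceExp {ι : Type*} {ρ : Measure (ι → ℝ≥0)}
    [IsProbabilityMeasure ρ] {T : (ι → ℝ≥0) → ι → ℝ≥0} (hT : MeasurePreserving T ρ ρ)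
    (hmix : ∀ l m, Tendsto (fun n : ℕ => ∫ x, laplaceExp l (T^[n] x) * laplaceExp m x ∂ρ) atTop
      (𝓝 ((∫ x, laplaceExp l x ∂ρ) * ∫ x, laplaceExp m x ∂ρ))) : Ergodic T ρ := by
  refine ⟨hT, ⟨fun A hA hTA => ?_⟩⟩
  have hTn (n : ℕ) : MeasurePreserving T^[n] ρ ρ := hT.iterate n
  have hTnA (n : ℕ) : T^[n] ⁻¹' A = A := by
    induction n with
    | zero => rfl
    | succ n ih => rw [Function.iterate_succ, preimage_comp, ih, hTA]
  -- The centred functions `laplaceExp l ∘ T^[n] - c` tend weakly to `0` in `L²`. Pairing them with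
  -- the indicator of `A` gives a sequence that is constant in `n`, by invariance of `A` and `ρ`.
  have key (l : ι →₀ ℝ≥0) : ∫ x in A, laplaceExp l x ∂ρ = ρ.real A * ∫ x, laplaceExp l x ∂ρ := by
    set c := ∫ x, laplaceExp l x ∂ρ with hc
    have hc0 : 0 ≤ c := integral_nonneg fun x => (laplaceExp_pos l x).le
    have hc1 : c ≤ 1 := by
      simpa using integral_mono (integrable_laplaceExp l ρ) (integrable_const 1)
        (laplaceExp_le_one l)
    have hmeas (n : ℕ) : Measurable fun x => laplaceExp l (T^[n] x) - c :=
      ((measurable_laplaceExp l).comp (hTn n).measurable).sub_const c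
    have hbd (n : ℕ) (x : ι → ℝ≥0) : ‖laplaceExp l (T^[n] x) - c‖ ≤ 1 := by
      rw [Real.norm_eq_abs, abs_le]
      constructor <;> linarith [laplaceExp_pos l (T^[n] x), laplaceExp_le_one l (T^[n] x)]
    have hmem (n : ℕ) : MemLp (fun x => laplaceExp l (T^[n] x) - c) 2 ρ :=
      .of_bound (hmeas n).aestronglyMeasurable 1 (ae_of_all _ (hbd n))
    have hinner (n : ℕ) {f : (ι → ℝ≥0) → ℝ} (hf : MemLp f 2 ρ) :
        inner ℝ (hmem n).toLp hf.toLp =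
          ∫ x, laplaceExp l (T^[n] x) * f x ∂ρ - c * ∫ x, f x ∂ρ := by
      have hfi := hf.integrable (by norm_num)
      rw [L2.inner_def, ← integral_const_mul, ← integral_sub]
      · refine integral_congr_ae ?_
        filter_upwards [(hmem n).coeFn_toLp, hf.coeFn_toLp] with x h1 h2
        rw [h1, h2]
        simp
        ring
      · exact hfi.bdd_mul
          ((measurable_laplaceExp l).comp (hTn n).measurable).aestronglyMeasurable
          (ae_of_all _ fun x => norm_laplaceExp_le_one l _)
      · exact hfi.const_mul c
    have hA2 : MemLp (A.indicator fun _ => (1 : ℝ)) 2 ρ :=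
      memLp_indicator_const 2 hA 1 (Or.inr (measure_ne_top _ _))
    have hlim := tendsto_inner_zero_of_total (w := fun n => (hmem n).toLp) (C := 1)
      (fun n => by
        have hae : ∀ᵐ x ∂ρ, ‖((hmem n).toLp : Lp ℝ 2 ρ) x‖ ≤ 1 := by
          filter_upwards [(hmem n).coeFn_toLp] with x h1
          rw [h1]
          exact hbd n x
        have hu : measureUnivNNReal ρ = 1 := by simp [measureUnivNNReal]
        simpa [hu] using Lp.norm_le_of_ae_bound zero_le_one hae)
      (span_laplaceExp_dense ρ)
      (by
        rintro _ ⟨m, rfl⟩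
        simp only [hinner]
        simpa [← hc] using (hmix l m).sub_const (c * ∫ x, laplaceExp m x ∂ρ))
      hA2.toLp
    simp only [hinner] at hlim
    have hconst (n : ℕ) : ∫ x, laplaceExp l (T^[n] x) * A.indicator (fun _ => (1 : ℝ)) x ∂ρ =
        ∫ x in A, laplaceExp l x ∂ρ := by
      have hmap := integral_map (μ := ρ) (hTn n).measurable.aemeasurable
        (f := A.indicator (laplaceExp l))
        ((measurable_laplaceExp l).indicator hA).aestronglyMeasurable
      rw [(hTn n).map_eq] at hmap
      rw [← integral_indicator hA, hmap]
      refine integral_congr_ae (ae_of_all _ fun x => ?_)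
      have hx : T^[n] x ∈ A ↔ x ∈ A := by
        rw [← mem_preimage, hTnA n]
      by_cases hxA : x ∈ A <;> simp [hxA, hx]
    simp only [hconst] at hlim
    have := tendsto_nhds_unique hlim tendsto_const_nhds
    rw [integral_indicator hA] at this
    simp at this
    linarith
  have hmeq : ρ.restrict A = ρ A • ρ := by
    have : IsFiniteMeasure (ρ A • ρ) := ρ.smul_finite (measure_ne_top _ _)
    refine ext_of_integral_laplaceExp fun l => ?_
    rw [key, integral_smul_measure]
    rfl
  -- Evaluating both measures at `A` itself: `A` is independent of itself.
  have hsq : ρ A = ρ A * ρ A := by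
    have := congrArg (fun ν => ν A) hmeq
    simpa using this
  rw [eventuallyConst_set']
  by_cases h0 : ρ A = 0
  · exact Or.inl (ae_eq_empty.2 h0)
  · refine Or.inr (ae_eq_univ.2 ((prob_compl_eq_zero_iff hA).2 ?_))
    have := (ENNReal.mul_eq_left h0 (measure_ne_top ρ A)).1 hsq.symm
    exact this

/-! ### Decay of `v_t` and integrability of `ψ(v_t)` -/

section Exponent

theorem cbExponent_nonneg (b : ℝ) {c t l : ℝ} (hc : 0 ≤ c) (hl : 0 ≤ l) (ht : 0 ≤ t) :
    0 ≤ cbExponent b c t l :=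
  div_nonneg (by positivity) (cbExponent_denom_pos b hc hl ht).le

theorem branchingMechanism_pos {b c : ℝ} (hb : 0 ≤ b) (hc : 0 ≤ c)
    (hφ : ∀ z : ℝ, 0 < z → branchingMechanism b c z ≠ 0) {z : ℝ} (hz : 0 < z) :
    0 < branchingMechanism b c z :=
  lt_of_le_of_ne (by unfold branchingMechanism; positivity) (hφ z hz).symm

theorem cbExponent_strictAntiOn {b c l : ℝ} (hb : 0 ≤ b) (hc : 0 ≤ c)
    (hφ : ∀ z : ℝ, 0 < z → branchingMechanism b c z ≠ 0) (hl : 0 < l) :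
    StrictAntiOn (fun t => cbExponent b c t l) (Ici 0) := by
  refine strictAntiOn_of_deriv_neg (convex_Ici 0)
    (fun t ht => (cbExponent_hasDerivAt b hc hl.le ht).continuousAt.continuousWithinAt)
    fun t ht => ?_
  rw [interior_Ici] at ht
  have ht0 : 0 ≤ t := (mem_Ioi.1 ht).le
  rw [(cbExponent_hasDerivAt b hc hl.le ht0).deriv]
  exact neg_neg_of_pos (branchingMechanism_pos hb hc hφ (cbExponent_pos b hc hl ht0))

/-- If `b > 0`, `v_t(l)` is dominated by `e^{-bt} l`. If `b = 0`, nonvanishing of `φ` forces `c >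
0`, and the denominator grows linearly. -/
theorem cbExponent_tendsto_zero {b c l : ℝ} (hb : 0 ≤ b) (hc : 0 ≤ c)
    (hφ : ∀ z : ℝ, 0 < z → branchingMechanism b c z ≠ 0) (hl : 0 ≤ l) :
    Tendsto (fun t => cbExponent b c t l) atTop (𝓝 0) := by
  rcases hl.eq_or_lt with rfl | hl'
  · simp [cbExponent]
  rcases hb.eq_or_lt with rfl | hb'
  · have hc' : 0 < c := by
      refine lt_of_le_of_ne hc fun h => hφ 1 one_pos ?_
      simp [branchingMechanism, ← h]
    have : (fun t => cbExponent 0 c t l) = fun t => l / (1 + c * l * t) := by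
      ext t; simp [cbExponent]
    rw [this]
    exact tendsto_const_nhds.div_atTop (tendsto_atTop_add_const_left _ _
      (tendsto_id.const_mul_atTop (by positivity)))
  · have hexp : Tendsto (fun t => Real.exp (-b * t) * l) atTop (𝓝 0) := by
      have := (Real.tendsto_exp_atBot.comp
        (tendsto_id.const_mul_atTop_of_neg (neg_neg_of_pos hb'))).mul_const l
      simpa using this
    refine tendsto_of_tendsto_of_tendsto_of_le_of_le' tendsto_const_nhds hexp ?_ ?_
    · filter_upwards [eventually_ge_atTop 0] with t ht using cbExponent_nonneg b hc hl ht
    · filter_upwards [eventually_ge_atTop 0] with t ht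
      refine div_le_self (by positivity) ?_
      have : 0 ≤ ∫ s in (0 : ℝ)..t, Real.exp (-b * s) :=
        intervalIntegral.integral_nonneg ht fun _ _ => (Real.exp_pos _).le
      have : 0 ≤ c * l * ∫ s in (0 : ℝ)..t, Real.exp (-b * s) := by positivity
      linarith

/-- The bound is `1 - e^{-zu} ≤ max(1,z) · min(1,u)`. -/
theorem integrableOn_one_sub_exp {n : Measure ℝ}
    (hn : ∫⁻ u in Ioi (0 : ℝ), ENNReal.ofReal (min 1 u) ∂n < ∞) {z : ℝ} (hz : 0 ≤ z) :
    IntegrableOn (fun u => 1 - Real.exp (-(z * u))) (Ioi 0) n := by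
  have hmin : IntegrableOn (fun u : ℝ => min 1 u) (Ioi 0) n := by
    refine ⟨by fun_prop, ?_⟩
    rw [hasFiniteIntegral_iff_ofReal]
    · exact hn
    · filter_upwards [ae_restrict_mem measurableSet_Ioi] with u hu
      exact le_min zero_le_one (le_of_lt hu)
  refine (hmin.const_mul (max 1 z)).mono' (by fun_prop) ?_
  filter_upwards [ae_restrict_mem measurableSet_Ioi] with u hu
  have hu0 : 0 ≤ u := le_of_lt hu
  have h1 : Real.exp (-(z * u)) ≤ 1 := Real.exp_le_one_iff.2 (neg_nonpos.2 (by positivity))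
  have h2 := Real.add_one_le_exp (-(z * u))
  rw [Real.norm_of_nonneg (by linarith)]
  rcases le_total 1 u with h | h
  · rw [min_eq_left h, mul_one]
    linarith [le_max_left 1 z, Real.exp_pos (-(z * u))]
  · rw [min_eq_right h]
    nlinarith [le_max_right 1 z]

theorem immigrationRate_monotoneOn {a : ℝ} {n : Measure ℝ} (ha : 0 ≤ a)
    (hn : ∫⁻ u in Ioi (0 : ℝ), ENNReal.ofReal (min 1 u) ∂n < ∞) :
    MonotoneOn (immigrationRate a n) (Ici 0) := by
  intro x hx y hy hxy
  refine add_le_add (mul_le_mul_of_nonneg_left hxy ha) (setIntegral_mono_on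
    (integrableOn_one_sub_exp hn hx) (integrableOn_one_sub_exp hn hy) measurableSet_Ioi
    fun u hu => ?_)
  have hu0 : 0 ≤ u := le_of_lt hu
  gcongr

/-- Since `v` decreases strictly with speed `φ(v)`, the substitution `z = v_s(r)` turns the tail of
the integral into part of the integral of `ψ/φ` near `0`. -/
theorem integrableOn_immigrationRate_cbExponent {b c a : ℝ} {n : Measure ℝ} (hb : 0 ≤ b)
    (hc : 0 ≤ c) (ha : 0 ≤ a) (hn : ∫⁻ u in Ioi (0 : ℝ), ENNReal.ofReal (min 1 u) ∂n < ∞)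
    (hφ : ∀ z : ℝ, 0 < z → branchingMechanism b c z ≠ 0)
    (hψφ : ∃ l : ℝ, 0 < l ∧
      IntegrableOn (fun z => immigrationRate a n z / branchingMechanism b c z) (Ioc 0 l))
    {r : ℝ} (hr : 0 ≤ r) :
    IntegrableOn (fun s => immigrationRate a n (cbExponent b c s r)) (Ioi 0) := by
  rcases hr.eq_or_lt with rfl | hr'
  · simp [cbExponent, immigrationRate]
  obtain ⟨l, hl, hint⟩ := hψφ
  have hanti := cbExponent_strictAntiOn hb hc hφ hr'
  -- The hypothesis controls `ψ/φ` only on `(0, l]`, so the substitution is used after `v` has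
  -- dropped below `l`; before that, monotonicity on a compact interval suffices.
  obtain ⟨s₁, hs₁, hs₁0⟩ := (((cbExponent_tendsto_zero hb hc hφ hr).eventually_lt_const hl).and
    (eventually_ge_atTop 0)).exists
  rw [← Ioc_union_Ioi_eq_Ioi hs₁0]
  refine IntegrableOn.union ?_ ?_
  · refine IntegrableOn.mono_set ?_ (Ioc_subset_Icc_self (a := 0) (b := s₁))
    refine AntitoneOn.integrableOn_isCompact isCompact_Icc fun x hx y hy hxy => ?_
    exact immigrationRate_monotoneOn ha hn (cbExponent_nonneg b hc hr hy.1)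
      (cbExponent_nonneg b hc hr hx.1) (hanti.antitoneOn hx.1 hy.1 hxy)
  · have hsub : Ioi s₁ ⊆ Ici 0 := fun x hx => hs₁0.trans (le_of_lt hx)
    have himg : (fun t => cbExponent b c t r) '' Ioi s₁ ⊆ Ioc 0 l := by
      rintro _ ⟨t, ht, rfl⟩
      exact ⟨cbExponent_pos b hc hr' (hsub ht),
        (hanti hs₁0 (hsub ht) ht).le.trans hs₁.le⟩
    have := (integrableOn_image_iff_integrableOn_abs_deriv_smul measurableSet_Ioi
      (fun t ht => (cbExponent_hasDerivAt b hc hr (hsub ht)).hasDerivWithinAt)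
      (hanti.injOn.mono hsub) _).1 (hint.mono_set himg)
    refine this.congr_fun (fun t ht => ?_) measurableSet_Ioi
    have hpos := branchingMechanism_pos hb hc hφ (cbExponent_pos b hc hr' (hsub ht))
    simp only [abs_neg, abs_of_pos hpos, smul_eq_mul]
    field_simp

end Exponent

/-! ### Stationarity and reduction to finitely many times -/

section PathSpace

theorem measurable_timeShift (h : ℝ) : Measurable (timeShift h) :=
  measurable_pi_lambda _ fun _ => measurable_pi_apply _

theorem measurable_pi_comp {ι κ : Type*} (r : κ → ι) :
    Measurable fun (x : ι → ℝ≥0) i => x (r i) :=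
  measurable_pi_lambda _ fun _ => measurable_pi_apply _

theorem laplaceExp_timeShift (l : ℝ →₀ ℝ≥0) (h : ℝ) (x : ℝ → ℝ≥0) :
    laplaceExp l (timeShift h x) = laplaceExp (l.mapDomain (h + ·)) x :=
  (laplaceExp_mapDomain _ _ _).symm

theorem timeShift_iterate (h : ℝ) (k : ℕ) : (timeShift h)^[k] = timeShift (k * h) := by
  induction k with
  | zero => ext; simp [timeShift]
  | succ k ih =>
    rw [Function.iterate_succ, ih]
    ext x t
    simp only [timeShift, Function.comp_apply]
    congr 2
    push_cast
    ring

/-- Only time increments enter the kernels, and the initial law does not depend on the first time.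
This yields stationarity without proving `η P_t = η`. -/
theorem markovFDD_const_add (η : Measure ℝ≥0) (P : ℝ≥0 → Kernel ℝ≥0 ℝ≥0) (h : ℝ) (m : ℕ)
    (t : Fin (m + 1) → ℝ) : markovFDD η P m (fun i => h + t i) = markovFDD η P m t := by
  induction m with
  | zero => rfl
  | succ m ih =>
    simp only [markovFDD, add_sub_add_left_eq_sub]
    rw [ih fun i => t i.castSucc]

theorem integral_laplaceExp_eq_integral_map {ι κ : Type*} (ν : Measure (ι → ℝ≥0)) {r : κ → ι}
    (hr : Function.Injective r) (l : ι →₀ ℝ≥0) (hl : (l.support : Set ι) ⊆ range r) :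
    ∫ x, laplaceExp l x ∂ν =
      ∫ y, laplaceExp (l.comapDomain r hr.injOn) y ∂(ν.map fun x i => x (r i)) := by
  rw [integral_map (measurable_pi_comp r).aemeasurable (by fun_prop)]
  conv_lhs => rw [← Finsupp.mapDomain_comapDomain r hr l hl]
  simp only [laplaceExp_mapDomain]
  rfl

/-- Every finite set of times with largest element `s` is enumerated increasingly by some
`Fin (m + 1)`. -/
theorem exists_strictMono_range_of_le (l : ℝ →₀ ℝ≥0) {s : ℝ} (hl : ∀ i ∈ l.support, i ≤ s) :
    ∃ (m : ℕ) (r : Fin (m + 1) → ℝ), StrictMono r ∧ (l.support : Set ℝ) ⊆ range r ∧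
      r (Fin.last m) = s := by
  obtain ⟨m, hm⟩ : ∃ m, (insert s l.support).card = m + 1 :=
    Nat.exists_eq_succ_of_ne_zero (Finset.card_ne_zero_of_mem (Finset.mem_insert_self _ _))
  refine ⟨m, (insert s l.support).orderEmbOfFin hm, OrderEmbedding.strictMono _, ?_, ?_⟩
  · rw [Finset.range_orderEmbOfFin]
    simp
  · refine le_antisymm ?_ ?_
    · have := Finset.orderEmbOfFin_mem (insert s l.support) hm (Fin.last m)
      rcases Finset.mem_insert.1 this with h | h
      · exact h.le
      · exact hl _ h
    · have : s ∈ range ((insert s l.support).orderEmbOfFin hm) := by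
        rw [Finset.range_orderEmbOfFin]
        simp
      obtain ⟨i, hi⟩ := this
      conv_lhs => rw [← hi]
      exact (OrderEmbedding.monotone _) (Fin.le_last i)

variable {η : Measure ℝ≥0} {P : ℝ≥0 → Kernel ℝ≥0 ℝ≥0} {ρ : Measure (ℝ → ℝ≥0)}

theorem HasMarkovFDD.integral_laplaceExp_single (hρ : HasMarkovFDD ρ (fun t x => x t) η P)
    (s : ℝ) (r : ℝ≥0) :
    ∫ x, laplaceExp (Finsupp.single s r) x ∂ρ = ∫ y, Real.exp (-((r : ℝ) * (y : ℝ))) ∂η := by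
  have h := hρ 0 (fun _ => s) fun i j hij => absurd hij (by omega)
  simp only [laplaceExp_single]
  have h1 : ∫ x, Real.exp (-((r : ℝ) * (x 0 : ℝ))) ∂(ρ.map fun x (_ : Fin 1) => x s) =
      ∫ x, Real.exp (-((r : ℝ) * (x s : ℝ))) ∂ρ :=
    integral_map (measurable_pi_lambda _ fun _ => measurable_pi_apply _).aemeasurable
      (Measurable.aestronglyMeasurable (by fun_prop))
  have h2 : ∫ x, Real.exp (-((r : ℝ) * (x 0 : ℝ))) ∂(η.map fun y (_ : Fin 1) => y) =
      ∫ y, Real.exp (-((r : ℝ) * (y : ℝ))) ∂η :=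
    integral_map (by fun_prop) (Measurable.aestronglyMeasurable (by fun_prop))
  rw [← h1, ← h2]
  exact congrArg (fun ν => ∫ x : Fin 1 → ℝ≥0, Real.exp (-((r : ℝ) * (x 0 : ℝ))) ∂ν) h

variable [IsProbabilityMeasure ρ]

theorem HasMarkovFDD.measurePreserving_timeShift (hρ : HasMarkovFDD ρ (fun t x => x t) η P)
    (h : ℝ) : MeasurePreserving (timeShift h) ρ ρ := by
  refine ⟨measurable_timeShift h, ?_⟩
  have : IsFiniteMeasure (ρ.map (timeShift h)) := Measure.isFiniteMeasure_map _ _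
  refine ext_of_integral_laplaceExp fun l => ?_
  obtain ⟨s, hs⟩ := l.support.bddAbove
  obtain ⟨m, r, hr, hlr, -⟩ := exists_strictMono_range_of_le l fun i hi => hs hi
  rw [integral_laplaceExp_eq_integral_map _ hr.injective l hlr,
    integral_laplaceExp_eq_integral_map ρ hr.injective l hlr,
    Measure.map_map (measurable_pi_comp r) (measurable_timeShift h)]
  have h1 := hρ m (fun i => h + r i) fun i j hij => add_lt_add_right (hr hij) h
  have h2 := hρ m r hr
  rw [markovFDD_const_add] at h1
  rw [h2, ← h1]
  rfl

theorem HasMarkovFDD.integral_laplaceExp_timeShift (hρ : HasMarkovFDD ρ (fun t x => x t) η P)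
    (h : ℝ) (l : ℝ →₀ ℝ≥0) :
    ∫ x, laplaceExp (l.mapDomain (h + ·)) x ∂ρ = ∫ x, laplaceExp l x ∂ρ := by
  conv_rhs => rw [← (hρ.measurePreserving_timeShift h).map_eq]
  rw [integral_map (measurable_timeShift h).aemeasurable (by fun_prop)]
  simp only [laplaceExp_timeShift]

theorem measurable_snoc (m : ℕ) : Measurable fun p : (Fin m → ℝ≥0) × ℝ≥0 =>
    (Fin.snoc (α := fun _ => ℝ≥0) p.1 p.2 : Fin (m + 1) → ℝ≥0) := by
  refine measurable_pi_lambda _ fun i => ?_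
  refine Fin.lastCases ?_ (fun i => ?_) i
  · simpa using measurable_snd
  · simpa [Function.comp_def] using (measurable_pi_apply i).comp measurable_fst

theorem strictMono_snoc {m : ℕ} {r : Fin (m + 1) → ℝ} (hr : StrictMono r) {t : ℝ}
    (ht : r (Fin.last m) < t) :
    StrictMono (Fin.snoc (α := fun _ => ℝ) r t : Fin (m + 2) → ℝ) := by
  refine Fin.strictMono_iff_lt_succ.2 fun i => ?_
  refine Fin.lastCases ?_ (fun i => ?_) i
  · simpa using ht
  · rw [← Fin.castSucc_succ, Fin.snoc_castSucc, Fin.snoc_castSucc]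
    exact hr i.castSucc_lt_succ

/-! ### Markov property on exponentials and mixing of the shifts -/

variable {b c a : ℝ} {n : Measure ℝ}

/-- The Markov property on exponentials: the last time `t` is moved to an earlier time `s`. -/
theorem HasMarkovFDD.integral_laplaceExp_add_single (hc : 0 ≤ c) (hP : IsCBISemigroup b c a n P)
    (hρ : HasMarkovFDD ρ (fun t x => x t) η P) (l : ℝ →₀ ℝ≥0) {s t : ℝ}
    (hl : ∀ i ∈ l.support, i ≤ s) (hst : s ≤ t) (q : ℝ≥0) :
    ∫ x, laplaceExp (l + Finsupp.single t q) x ∂ρ =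
      Real.exp (-∫ u in (0 : ℝ)..(t - s), immigrationRate a n (cbExponent b c u q)) *
        ∫ x, laplaceExp (l + Finsupp.single s (cbExponent b c (t - s) q).toNNReal) x ∂ρ := by
  -- Equal times are treated apart, as `HasMarkovFDD` requires strictly increasing times.
  rcases hst.eq_or_lt with rfl | hst
  · simp [cbExponent_zero]
  obtain ⟨m, r, hr, hlr, hrs⟩ := exists_strictMono_range_of_le l hl
  have hv : 0 ≤ cbExponent b c (t - s) q :=
    cbExponent_nonneg b hc q.2 (sub_nonneg.2 hst.le)
  set f := laplaceExp (l.comapDomain r hr.injective.injOn)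
  have hfm : Measurable f := measurable_laplaceExp _
  have hlf (x : ℝ → ℝ≥0) : laplaceExp l x = f fun i => x (r i) := by
    conv_lhs => rw [← Finsupp.mapDomain_comapDomain r hr.injective l hlr]
    rw [laplaceExp_mapDomain]
    rfl
  have h1 := hρ m r hr
  have h2 := hρ (m + 1) (Fin.snoc (α := fun _ => ℝ) r t) (strictMono_snoc hr (hrs ▸ hst))
  simp only [markovFDD, Fin.snoc_castSucc, Fin.snoc_last, hrs] at h2
  rw [← h1] at h2
  set ν := ρ.map fun x i => x (r i) with hν
  have : IsProbabilityMeasure ν := Measure.isProbabilityMeasure_map (measurable_pi_comp r).aemeasurable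
  have hτ : ((t - s).toNNReal : ℝ) = t - s := Real.coe_toNNReal _ (sub_nonneg.2 hst.le)
  have := hP.isMarkovKernel (t - s).toNNReal
  have hbd (y : Fin (m + 1) → ℝ≥0) (z : ℝ≥0) : ‖f y * Real.exp (-((q : ℝ) * (z : ℝ)))‖ ≤ 1 := by
    rw [norm_mul]
    refine mul_le_one₀ (norm_laplaceExp_le_one _ _) (norm_nonneg _) ?_
    rw [Real.norm_of_nonneg (Real.exp_pos _).le]
    exact Real.exp_le_one_iff.2 (neg_nonpos.2 (by positivity))
  calc ∫ x, laplaceExp (l + Finsupp.single t q) x ∂ρ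
      = ∫ x, f (fun i => x (r i)) * Real.exp (-((q : ℝ) * (x t : ℝ))) ∂ρ := by
        simp only [laplaceExp_add, laplaceExp_single, hlf]
    _ = ∫ y : Fin (m + 2) → ℝ≥0, f (fun i => y i.castSucc) *
          Real.exp (-((q : ℝ) * (y (Fin.last (m + 1)) : ℝ)))
          ∂(ρ.map fun x i => x ((Fin.snoc (α := fun _ => ℝ) r t : Fin (m + 2) → ℝ) i)) := by
        rw [integral_map (measurable_pi_comp _).aemeasurable
          (Measurable.aestronglyMeasurable (by fun_prop))]
        simp only [Fin.snoc_castSucc, Fin.snoc_last]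
    _ = ∫ y, f y * Real.exp (-((y (Fin.last m) : ℝ) * cbExponent b c (t - s) q)
          - ∫ u in (0 : ℝ)..(t - s), immigrationRate a n (cbExponent b c u q)) ∂ν := by
        rw [h2, integral_map (measurable_snoc _).aemeasurable
          (Measurable.aestronglyMeasurable (by fun_prop))]
        simp only [Fin.snoc_castSucc, Fin.snoc_last]
        rw [Measure.integral_compProd (.of_bound (Measurable.aestronglyMeasurable (by fun_prop)) 1
          (ae_of_all _ fun p => hbd p.1 p.2))]
        refine integral_congr_ae (ae_of_all _ fun y => ?_)
        simp only [Kernel.comap_apply]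
        rw [integral_const_mul, hP.laplace _ _ (q : ℝ) q.2, hτ]
    _ = _ := by
        rw [hν, integral_map (measurable_pi_comp r).aemeasurable
          (Measurable.aestronglyMeasurable (by fun_prop)), ← integral_const_mul]
        refine integral_congr_ae (ae_of_all _ fun x => ?_)
        simp only [laplaceExp_add, laplaceExp_single, hlf, hrs, Real.coe_toNNReal _ hv]
        rw [sub_eq_add_neg, Real.exp_add, mul_comm (x s : ℝ)]
        ring

/-- Everything after a time `s` collapses to a single exponential at time `s`. -/
theorem HasMarkovFDD.exists_integral_laplaceExp_add (hc : 0 ≤ c) (hP : IsCBISemigroup b c a n P)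
    (hρ : HasMarkovFDD ρ (fun t x => x t) η P) (m : ℝ →₀ ℝ≥0) :
    ∀ s : ℝ, (∀ i ∈ m.support, s ≤ i) → ∃ (C : ℝ) (w : ℝ≥0), ∀ l : ℝ →₀ ℝ≥0,
      (∀ i ∈ l.support, i ≤ s) → ∫ x, laplaceExp (l + m) x ∂ρ =
        C * ∫ x, laplaceExp (l + Finsupp.single s w) x ∂ρ := by
  -- Peeling off the earliest time `t` lets the induction hypothesis collapse all later times onto
  -- `t`. Their weight `w` joins `q`, and `q + w` is then moved from `t` to `s`.
  induction m using Finsupp.induction_on_min with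
  | zero => exact fun s _ => ⟨1, 0, fun l _ => by simp⟩
  | single_add t q m htm hq ih =>
    intro s hs
    have hst : s ≤ t := hs t (by
      have : m t = 0 := by
        by_contra h
        exact lt_irrefl _ (htm t (Finsupp.mem_support_iff.2 h))
      simp [this, hq])
    obtain ⟨C, w, hCw⟩ := ih t fun i hi => (htm i hi).le
    refine ⟨C * Real.exp (-∫ u in (0 : ℝ)..(t - s),
      immigrationRate a n (cbExponent b c u ((q + w : ℝ≥0) : ℝ))),
      (cbExponent b c (t - s) ((q + w : ℝ≥0) : ℝ)).toNNReal, fun l hl => ?_⟩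
    have hsupp : ∀ i ∈ (l + Finsupp.single t q).support, i ≤ t := by
      intro i hi
      rcases Finset.mem_union.1 (Finsupp.support_add hi) with h | h
      · exact (hl i h).trans hst
      · rw [Finset.mem_singleton.1 (Finsupp.support_single_subset h)]
    rw [← add_assoc, hCw _ hsupp, add_assoc, ← Finsupp.single_add,
      hρ.integral_laplaceExp_add_single hc hP l hl hst, mul_assoc]

theorem tendsto_integral_laplaceExp_add_single (l : ℝ →₀ ℝ≥0) (s : ℝ) {v : ℕ → ℝ≥0}
    (hv : Tendsto v atTop (𝓝 0)) :
    Tendsto (fun k => ∫ x, laplaceExp (l + Finsupp.single s (v k)) x ∂ρ) atTop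
      (𝓝 (∫ x, laplaceExp l x ∂ρ)) := by
  refine tendsto_integral_of_dominated_convergence (fun _ => 1) (fun k => by fun_prop)
    (integrable_const 1) (fun k => ae_of_all _ fun x => norm_laplaceExp_le_one _ x)
    (ae_of_all _ fun x => ?_)
  simp only [laplaceExp_add, laplaceExp_single]
  have hcont : Continuous fun w : ℝ≥0 => laplaceExp l x * Real.exp (-((w : ℝ) * (x s : ℝ))) := by
    fun_prop
  simpa [Function.comp_def] using (hcont.tendsto 0).comp hv

theorem HasMarkovFDD.ergodic_timeShift (hb : 0 ≤ b) (hc : 0 ≤ c) (ha : 0 ≤ a)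
    (hn : ∫⁻ u in Ioi (0 : ℝ), ENNReal.ofReal (min 1 u) ∂n < ∞)
    (hφ : ∀ z : ℝ, 0 < z → branchingMechanism b c z ≠ 0)
    (hψφ : ∃ l : ℝ, 0 < l ∧
      IntegrableOn (fun z => immigrationRate a n z / branchingMechanism b c z) (Ioc 0 l))
    (hP : IsCBISemigroup b c a n P) (hη : IsCBIStationaryLaw b c a n η)
    (hρ : HasMarkovFDD ρ (fun t x => x t) η P) {h : ℝ} (hh : 0 < h) :
    Ergodic (timeShift h) ρ := by
  refine ergodic_of_tendsto_integral_laplaceExp (hρ.measurePreserving_timeShift h) fun l m => ?_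
  obtain ⟨s, hs⟩ := l.support.bddBelow
  obtain ⟨s₀, hs₀⟩ := m.support.bddAbove
  obtain ⟨C, w, hCw⟩ := hρ.exists_integral_laplaceExp_add hc hP l s fun i hi => hs hi
  -- The gap between `s` and the upper bound `s₀` for the times of `m`, after `m` is moved back by
  -- `k h`. By stationarity this replaces moving `l` forward, and it keeps `C` and `w` independent
  -- of `k`.
  set τ : ℕ → ℝ := fun k => s - (-(k * h) + s₀) with hτ
  have hτlim : Tendsto τ atTop atTop := by
    have : τ = fun k : ℕ => (k : ℝ) * h + (s - s₀) := by ext k; simp only [hτ]; ring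
    rw [this]
    exact tendsto_atTop_add_const_right _ _ (tendsto_natCast_atTop_atTop.atTop_mul_const hh)
  have hev : ∀ᶠ k : ℕ in atTop,
      C * (Real.exp (-∫ u in (0 : ℝ)..τ k, immigrationRate a n (cbExponent b c u w)) *
        ∫ x, laplaceExp (m + Finsupp.single s₀ (cbExponent b c (τ k) w).toNNReal) x ∂ρ) =
      ∫ x, laplaceExp l ((timeShift h)^[k] x) * laplaceExp m x ∂ρ := by
    filter_upwards [hτlim.eventually_ge_atTop 0] with k hk
    have hk' : -(k * h) + s₀ ≤ s := sub_nonneg.1 hk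
    have hsupp : ∀ i ∈ (m.mapDomain (-(k * h) + ·)).support, i ≤ -(k * h) + s₀ := by
      intro i hi
      obtain ⟨j, hj, rfl⟩ := Finset.mem_image.1 (Finsupp.mapDomain_support hi)
      exact add_le_add_right (hs₀ hj) _
    have hback : (l + m.mapDomain (-(k * h) + ·)).mapDomain (k * h + ·) =
        l.mapDomain (k * h + ·) + m := by
      rw [Finsupp.mapDomain_add, ← Finsupp.mapDomain_comp]
      have : ((k * h + ·) ∘ (-(k * h) + ·) : ℝ → ℝ) = id := by ext; simp
      rw [this, Finsupp.mapDomain_id]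
    simp only [timeShift_iterate, laplaceExp_timeShift, ← laplaceExp_add]
    rw [← hback, hρ.integral_laplaceExp_timeShift, add_comm l, hCw _ fun i hi =>
      (hsupp i hi).trans hk', hρ.integral_laplaceExp_add_single hc hP _ hsupp hk',
      ← hρ.integral_laplaceExp_timeShift (-(k * h))
        (m + Finsupp.single s₀ (cbExponent b c (τ k) w).toNNReal),
      Finsupp.mapDomain_add, Finsupp.mapDomain_single]
  refine Tendsto.congr' hev ?_
  have hl : ∫ x, laplaceExp l x ∂ρ = C * Real.exp (-∫ u in Ioi (0 : ℝ),
      immigrationRate a n (cbExponent b c u w)) := by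
    -- The collapse identity without any past identifies the limiting constant as the integral of
    -- `laplaceExp l`.
    have := hCw 0 (by simp)
    rwa [zero_add, zero_add, hρ.integral_laplaceExp_single, hη.laplace (w : ℝ) w.2] at this
  rw [hl, mul_assoc]
  have hvlim : Tendsto (fun k => (cbExponent b c (τ k) w).toNNReal) atTop (𝓝 0) := by
    have := (continuous_real_toNNReal.tendsto 0).comp
      ((cbExponent_tendsto_zero hb hc hφ w.2).comp hτlim)
    simpa [Function.comp_def] using this
  refine Tendsto.const_mul C (Tendsto.mul ?_ (tendsto_integral_laplaceExp_add_single m s₀ hvlim))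
  exact (Real.continuous_exp.tendsto _).comp (intervalIntegral_tendsto_integral_Ioi 0
    (integrableOn_immigrationRate_cbExponent hb hc ha hn hφ hψφ w.2) hτlim).neg

end PathSpace

/-- Ergodicity of the stationary CBI-process, for the flow of all time shifts and for each single
shift `θ_h`, `h > 0` (which is what a sampling of the process at the times `k h` uses). -/
theorem corollary2p3 (b c a : ℝ) (n : Measure ℝ) (hb : 0 ≤ b) (hc : 0 ≤ c) (ha : 0 ≤ a)
    (hn : ∫⁻ u in Ioi (0 : ℝ), ENNReal.ofReal (min 1 u) ∂n < ∞)
    (hφ : ∀ z : ℝ, 0 < z → branchingMechanism b c z ≠ 0)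
    (hψφ : ∃ l : ℝ, 0 < l ∧
      IntegrableOn (fun z => immigrationRate a n z / branchingMechanism b c z) (Ioc 0 l))
    (P : ℝ≥0 → Kernel ℝ≥0 ℝ≥0) (hP : IsCBISemigroup b c a n P)
    (η : Measure ℝ≥0) (hη : IsCBIStationaryLaw b c a n η)
    {Ω : Type*} [MeasurableSpace Ω] (μ : Measure Ω) [IsProbabilityMeasure μ]
    (Y : ℝ → Ω → ℝ≥0) (hY : ∀ t, Measurable (Y t)) (hfdd : HasMarkovFDD μ Y η P) :
    IsErgodicProcess μ Y ∧ ∀ h : ℝ, 0 < h → Ergodic (timeShift h) (pathLaw μ Y) := by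
  have hYm : Measurable fun ω t => Y t ω := measurable_pi_lambda _ hY
  have : IsProbabilityMeasure (pathLaw μ Y) := Measure.isProbabilityMeasure_map hYm.aemeasurable
  have hρ : HasMarkovFDD (pathLaw μ Y) (fun t x => x t) η P := by
    intro m t ht
    rw [← hfdd m t ht, pathLaw, Measure.map_map (measurable_pi_comp t) hYm]
    rfl
  have herg (h : ℝ) (hh : 0 < h) : Ergodic (timeShift h) (pathLaw μ Y) :=
    hρ.ergodic_timeShift hb hc ha hn hφ hψφ hP hη hh
  refine ⟨⟨hρ.measurePreserving_timeShift, fun A hA hAinv => ?_⟩, herg⟩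
  -- Almost-everywhere invariance under the unit shift alone already suffices.
  rcases (herg 1 one_pos).quasiErgodic.ae_empty_or_univ₀ hA.nullMeasurableSet (hAinv 1) with h | h
  · exact Or.inl (ae_eq_empty.1 h)
  · exact Or.inr ((prob_compl_eq_zero_iff hA).1 (ae_eq_univ.1 h))
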